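/- Let $G$ be a (Gromov) hyperbolic group, i.e. a group with a finite generating set $\mathcal A$ such that, for some $\delta\ge 0$, all geodesic triangles in the Cayley graph of $G$ with respect to $\mathcal A$ are $\delta$-slim (each side lies in the $\delta$-neighbourhood of the union of the two others). Let $H\lhd G$ be a finitely generated normal subgroup that is non-elementary, i.e. contains no cyclic subgroup of finite index (in $H$), and let $E_G(H)$ denote the largest finite subgroup of $G$ normalized by $H$ (it exists because $G$ is hyperbolic and $H$ is non-elementary). Let $T_H=\{(g_1,g_2)\in G\times G : g_1H=g_2H\}\le G\times G$ be the fibre product associated to $H$. Suppose that $E_G(H)=\{1\}$ and that $T_H$ is conjugacy separable, i.e. any two non-conjugate elements $x,y\in T_H$ have non-conjugate images under some homomorphism from $T_H$ to a finite group. Then $G/H$ is residually finite, i.e. for every two distinct elements of $G/H$ there is a homomorphism from $G/H$ to a finite group that maps them to distinct elements. -/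

import Mathlib

universe u

/-- The geodesic triangles of the graph `Γ` are `δ`-slim: whenever `p`, `q`, `r` are edge paths of
minimal length forming the sides of a triangle with corners `x`, `y`, `z`, every vertex of the side
`p` is at distance at most `δ` from a vertex of one of the two other sides. As the corners are
arbitrary and geodesics can be reversed, this bounds each of the three sides. -/
def SimpleGraph.HasSlimTriangles {V : Type u} (Γ : SimpleGraph V) (δ : ℕ) : Prop :=
  ∀ (x y z : V) (p : Γ.Walk x y) (q : Γ.Walk y z) (r : Γ.Walk x z),
    p.length = Γ.dist x y → q.length = Γ.dist y z → r.length = Γ.dist x z →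
      ∀ a ∈ p.support, ∃ b, (b ∈ q.support ∨ b ∈ r.support) ∧ Γ.dist a b ≤ δ

/-- A group is (Gromov) hyperbolic if it has a finite generating set `S` such that, for some `δ`,
all geodesic triangles of the Cayley graph with respect to `S` are `δ`-slim. The Cayley graph
`SimpleGraph.mulCayley S` joins distinct `g`, `h` when `g⁻¹ * h` or its inverse lies in `S`, so
that it is the Cayley graph of the symmetrized generating set `S ∪ S⁻¹`. -/
def Group.IsGromovHyperbolic (G : Type u) [Group G] : Prop :=
  ∃ S : Set G, S.Finite ∧ Subgroup.closure S = ⊤ ∧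
    ∃ δ : ℕ, (SimpleGraph.mulCayley S).HasSlimTriangles δ

/-- A subgroup is elementary if it contains a cyclic subgroup of finite index. -/
def Subgroup.IsElementary {G : Type u} [Group G] (H : Subgroup G) : Prop :=
  ∃ C : Subgroup H, IsCyclic C ∧ C.FiniteIndex

/-- The subgroup `E_G(H)`: the largest finite subgroup of `G` normalized by `H`, obtained as the
join of all such subgroups (the two agree as soon as there is a largest one, which is the case for
non-elementary subgroups of hyperbolic groups). -/
def Subgroup.maxFiniteNormalized {G : Type u} [Group G] (H : Subgroup G) : Subgroup G :=
  sSup {K : Subgroup G | Finite K ∧ H ≤ Subgroup.normalizer (K : Set G)}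

/-- If there is a largest finite subgroup normalized by `H`, it is `H.maxFiniteNormalized`. -/
theorem Subgroup.maxFiniteNormalized_eq_of_isGreatest {G : Type u} [Group G] {H E : Subgroup G}
    (hE : IsGreatest {K : Subgroup G | Finite K ∧ H ≤ Subgroup.normalizer (K : Set G)} E) :
    H.maxFiniteNormalized = E :=
  hE.csSup_eq

/-- The fibre product `{(g₁, g₂) | g₁ N = g₂ N} ≤ G × G` associated to the normal subgroup `N`. -/
def Subgroup.fibreProduct {G : Type u} [Group G] (N : Subgroup G) [N.Normal] : Subgroup (G × G) :=
  ((QuotientGroup.mk' N).comp (MonoidHom.fst G G)).eqLocus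
    ((QuotientGroup.mk' N).comp (MonoidHom.snd G G))

/-- A group is conjugacy separable if any two non-conjugate elements have non-conjugate images
under some homomorphism to a finite group. -/
def Group.IsConjugacySeparable (G : Type u) [Group G] : Prop :=
  ∀ x y : G, ¬ IsConj x y →
    ∃ (Q : Type u) (_ : Group Q) (_ : Finite Q) (ψ : G →* Q), ¬ IsConj (ψ x) (ψ y)

/-! Let `x` lie in every finite-index subgroup containing `H`; the claim is `x ∈ H`. For `h ∈ H`, no
finite quotient of the fibre product separates the classes of `(h, h)` and `(h, x h x⁻¹)`, so these
are conjugate, and some element of `xH` commutes with `h`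
(`Group.IsConjugacySeparable.exists_commute`). It remains to see that such an `x` lies in `H`
(`HypMetric.mem_of_forall_exists_commute`).

`H` contains a loxodromic `a` (`exists_lox_of_infinite`). If `b ∈ H` does not commensurate `a`, then
for suitable large `n` whatever commutes with `a ^ n * b` is, up to a power of `a ^ n * b`, a
torsion element that commutes with `b` and belongs to a finite set depending only on `a`
(`Lox.exists_exponent_commute`, `Lox.finite_torsion`). Hence `H` is covered by the commensurator of
`a` and the centralizers of finitely many `e ∈ xH`. By B. H. Neumann's lemma one of these has finite
index in `H`, and not the commensurator, as `H` is non-elementary. So some `e ∈ xH` is centralized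
by a finite-index subgroup of `H`; its `H`-conjugates generate a finite subgroup normalized by `H`,
which is trivial. Thus `e = 1` and `x ∈ H`. -/

/-- A left-invariant proper integer-valued metric on a group which is discretely geodesic and
satisfies the four-point condition of Gromov with constant `D` (for doubled Gromov products). -/
structure HypMetric (G : Type u) [Group G] where
  d : G → G → ℕ
  D : ℕ
  self : ∀ x, d x x = 0
  symm : ∀ x y, d x y = d y x
  tri : ∀ x y z, d x z ≤ d x y + d y z
  mul_left : ∀ g x y, d (g * x) (g * y) = d x y
  finite_ball : ∀ n, {g | d 1 g ≤ n}.Finite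
  interm : ∀ x y r, r ≤ d x y → ∃ z, d x z = r ∧ d z y + r = d x y
  four : ∀ x y z w, d x z + d y w ≤ d x y + d z w + D ∨ d x z + d y w ≤ d y z + d x w + D

/-! ### From slim triangles to the four-point condition -/

namespace SimpleGraph

variable {V : Type u} {Γ : SimpleGraph V}

theorem Walk.dist_getVert_of_length_eq_dist (hc : Γ.Connected) {x y : V} (p : Γ.Walk x y)
    (hp : p.length = Γ.dist x y) {i : ℕ} (hi : i ≤ p.length) :
    Γ.dist x (p.getVert i) = i ∧ Γ.dist (p.getVert i) y + i = Γ.dist x y := by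
  have h1 := Γ.dist_le (p.take i)
  have h2 := Γ.dist_le (p.drop i)
  have h3 := hc.dist_triangle (u := x) (v := p.getVert i) (w := y)
  rw [Walk.take_length] at h1
  rw [Walk.drop_length] at h2
  omega

/-- Some vertex of `p` is close to both other sides of the triangle with apex `w`, so its distance
to `w` exceeds the Gromov product of `x` and `y` at `w` by at most `2 * δ + 1`. -/
theorem HasSlimTriangles.exists_mem_support_dist_le {δ : ℕ} (hc : Γ.Connected)
    (h : Γ.HasSlimTriangles δ) {x y : V} (w : V) (p : Γ.Walk x y) (hp : p.length = Γ.dist x y) :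
    ∃ a ∈ p.support, 2 * Γ.dist w a + Γ.dist x y ≤ Γ.dist w x + Γ.dist w y + 4 * δ + 2 := by
  classical
  obtain ⟨q, hq⟩ := hc.exists_walk_length_eq_dist y w
  obtain ⟨r, hr⟩ := hc.exists_walk_length_eq_dist x w
  have slim := h x y w p q r hp hq hr
  let P : ℕ → Prop := fun i => ∃ b ∈ q.support, Γ.dist (p.getVert i) b ≤ δ
  have hP : P p.length := ⟨y, q.start_mem_support, by simp⟩
  have hex : ∃ i, P i := ⟨_, hP⟩
  obtain ⟨i, hi, hPi, hmin⟩ : ∃ i, i ≤ p.length ∧ P i ∧ ∀ j < i, ¬ P j :=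
    ⟨Nat.find hex, Nat.find_le hP, Nat.find_spec hex, fun j hj => Nat.find_min hex hj⟩
  obtain ⟨c, hcq, hc1⟩ := hPi
  -- `i` is the first index near `q`, so its predecessor is near `r`; the extra `1` is the edge
  -- between them.
  obtain ⟨b, hb, hb1⟩ : ∃ b ∈ r.support, Γ.dist (p.getVert i) b ≤ δ + 1 := by
    rcases Nat.eq_zero_or_pos i with rfl | hpos
    · exact ⟨x, r.start_mem_support, by simp⟩
    · obtain ⟨b, hb, hb1⟩ := slim (p.getVert (i - 1)) (p.getVert_mem_support _)
      have hbr : b ∈ r.support := by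
        rcases hb with hb | hb
        · exact absurd ⟨b, hb, hb1⟩ (hmin (i - 1) (by omega))
        · exact hb
      have hadj := p.adj_getVert_succ (i := i - 1) (by omega)
      rw [Nat.sub_add_cancel hpos] at hadj
      have h1 := dist_eq_one_iff_adj.mpr hadj.symm
      have h2 := hc.dist_triangle (u := p.getVert i) (v := p.getVert (i - 1)) (w := b)
      exact ⟨b, hbr, by omega⟩
  obtain ⟨ka, rfl, hka⟩ := Walk.mem_support_iff_exists_getVert.mp hb
  obtain ⟨kc, rfl, hkc⟩ := Walk.mem_support_iff_exists_getVert.mp hcq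
  have e1 := r.dist_getVert_of_length_eq_dist hc hr hka
  have e2 := q.dist_getVert_of_length_eq_dist hc hq hkc
  have e3 := p.dist_getVert_of_length_eq_dist hc hp hi
  refine ⟨p.getVert i, p.getVert_mem_support _, ?_⟩
  generalize p.getVert i = a at *
  generalize r.getVert ka = b at *
  generalize q.getVert kc = c at *
  have t1 := hc.dist_triangle (u := w) (v := b) (w := a)
  have t2 := hc.dist_triangle (u := w) (v := c) (w := a)
  have t3 := hc.dist_triangle (u := x) (v := b) (w := a)
  have t4 := hc.dist_triangle (u := a) (v := c) (w := y)
  rw [Γ.dist_comm (u := b) (v := a), Γ.dist_comm (u := w) (v := b)] at *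
  rw [Γ.dist_comm (u := c) (v := a), Γ.dist_comm (u := w) (v := c)] at *
  rw [Γ.dist_comm (u := c) (v := y)] at *
  rw [Γ.dist_comm (u := w) (v := x), Γ.dist_comm (u := w) (v := y)]
  omega

/-- The point `a` of `[y, w]` near `x` is `δ`-close to `[w, z]` or to `[y, z]`; a detour through
that side gives the corresponding alternative. -/
theorem HasSlimTriangles.four_point {δ : ℕ} (hc : Γ.Connected) (h : Γ.HasSlimTriangles δ)
    (x y z w : V) :
    Γ.dist x z + Γ.dist y w ≤ Γ.dist x y + Γ.dist z w + (6 * δ + 2) ∨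
      Γ.dist x z + Γ.dist y w ≤ Γ.dist y z + Γ.dist x w + (6 * δ + 2) := by
  obtain ⟨p, hp⟩ := hc.exists_walk_length_eq_dist y w
  obtain ⟨q, hq⟩ := hc.exists_walk_length_eq_dist w z
  obtain ⟨r, hr⟩ := hc.exists_walk_length_eq_dist y z
  obtain ⟨a, ha, ha1⟩ := h.exists_mem_support_dist_le hc x p hp
  obtain ⟨b, hb, hb1⟩ := h y w z p q r hp hq hr a ha
  have t1 := hc.dist_triangle (u := x) (v := a) (w := b)
  have t2 := hc.dist_triangle (u := x) (v := b) (w := z)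
  have t3 := hc.dist_triangle (u := x) (v := b) (w := w)
  have t4 := hc.dist_triangle (u := x) (v := b) (w := y)
  rcases hb with hb | hb
  all_goals
    obtain ⟨k, rfl, hk⟩ := Walk.mem_support_iff_exists_getVert.mp hb
  · have e := q.dist_getVert_of_length_eq_dist hc hq hk
    generalize q.getVert k = b at *
    rw [Γ.dist_comm (u := w) (v := b), Γ.dist_comm (u := w) (v := z),
      Γ.dist_comm (u := x) (v := y)] at *
    left; omega
  · have e := r.dist_getVert_of_length_eq_dist hc hr hk
    generalize r.getVert k = b at *
    rw [Γ.dist_comm (u := y) (v := b)] at *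
    right; omega

variable {G : Type u} [Group G]

theorem mulCayley_connected {S : Set G} (hS : Subgroup.closure S = ⊤) :
    (mulCayley S).Connected := by
  have key : ∀ g ∈ Subgroup.closure S, ∀ x, (mulCayley S).Reachable x (x * g) := by
    intro g hg
    induction hg using Subgroup.closure_induction with
    | mem g hg =>
      intro x
      by_cases h : x = x * g
      · rw [← h]
      · exact Adj.reachable ((mulCayley_adj S x (x * g)).mpr ⟨h, Or.inl (by simpa using hg)⟩)
    | one => intro x; simp
    | mul g k _ _ ihg ihk =>
      intro x
      rw [← mul_assoc]
      exact (ihg x).trans (ihk _)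
    | inv g _ ih =>
      intro x
      simpa using (ih (x * g⁻¹)).symm
  have : Nonempty G := ⟨1⟩
  refine ⟨fun x y => ?_⟩
  simpa using key (x⁻¹ * y) (hS ▸ Subgroup.mem_top _) x

theorem mulCayley_dist_mul_left_le {S : Set G} (hc : (mulCayley S).Connected) (g x y : G) :
    (mulCayley S).dist (g * x) (g * y) ≤ (mulCayley S).dist x y := by
  obtain ⟨p, hp⟩ := hc.exists_walk_length_eq_dist x y
  let f : mulCayley S →g mulCayley S := ⟨(g * ·), (mulCayley_adj_mul_iff_right).mpr⟩
  have := (mulCayley S).dist_le (p.map f)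
  rwa [Walk.length_map, hp] at this

theorem mulCayley_finite_ball {S : Set G} (hfin : S.Finite) (hc : (mulCayley S).Connected) (n : ℕ) :
    {g | (mulCayley S).dist 1 g ≤ n}.Finite := by
  induction n with
  | zero =>
    refine (Set.finite_singleton (1 : G)).subset fun g hg => ?_
    have := hc.dist_eq_zero_iff.mp (Nat.le_zero.mp hg)
    exact this.symm
  | succ n ih =>
    have hT : (S ∪ S⁻¹ ∪ {1}).Finite := (hfin.union hfin.inv).union (Set.finite_singleton 1)
    refine (ih.mul hT).subset fun g hg => ?_
    obtain ⟨p, hp⟩ := hc.exists_walk_length_eq_dist 1 g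
    by_cases h0 : p.length ≤ n
    · exact ⟨g, by simpa [← hp] using h0, 1, by simp, by simp⟩
    · have hadj := p.adj_getVert_succ (i := n) (by omega)
      have hlen : p.length = n + 1 := by
        have : (mulCayley S).dist 1 g ≤ n + 1 := hg
        omega
      rw [← hlen, p.getVert_length, mulCayley_adj] at hadj
      refine ⟨p.getVert n, ?_, (p.getVert n)⁻¹ * g, ?_, by simp⟩
      · have := (p.dist_getVert_of_length_eq_dist hc hp (i := n) (by omega)).1
        exact this.le
      · rcases hadj.2 with h | h
        · simp [h]
        · simp [h]

end SimpleGraph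

theorem Group.IsGromovHyperbolic.nonempty_hypMetric {G : Type u} [Group G]
    (hG : Group.IsGromovHyperbolic G) : Nonempty (HypMetric G) := by
  obtain ⟨S, hfin, hS, δ, hδ⟩ := hG
  have hc := SimpleGraph.mulCayley_connected hS
  refine ⟨⟨(SimpleGraph.mulCayley S).dist, 6 * δ + 2, fun x => SimpleGraph.dist_self,
    fun x y => SimpleGraph.dist_comm, fun x y z => hc.dist_triangle, fun g x y => le_antisymm
      (SimpleGraph.mulCayley_dist_mul_left_le hc g x y) ?_,
    SimpleGraph.mulCayley_finite_ball hfin hc, ?_, hδ.four_point hc⟩⟩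
  · simpa using SimpleGraph.mulCayley_dist_mul_left_le hc g⁻¹ (g * x) (g * y)
  · intro x y r hr
    obtain ⟨p, hp⟩ := hc.exists_walk_length_eq_dist x y
    exact ⟨p.getVert r, p.dist_getVert_of_length_eq_dist hc hp (by omega)⟩

/-! ### Chains of powers and points near them -/

namespace HypMetric

variable {G : Type u} [Group G] (M : HypMetric G)

theorem d_self_mul (x b : G) : M.d x (x * b) = M.d 1 b := by
  simpa using M.mul_left x 1 b

theorem d_eq_one (x y : G) : M.d x y = M.d 1 (x⁻¹ * y) := by
  simpa using M.d_self_mul x (x⁻¹ * y)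

theorem d_one_inv (x : G) : M.d 1 x⁻¹ = M.d 1 x := by
  rw [M.symm 1 x, M.d_eq_one x 1, mul_one]

theorem d_mul_left_one (x g : G) : M.d (x * g) 1 = M.d g x⁻¹ := by
  simpa using M.mul_left x g x⁻¹

theorem d_zpow (w : G) (i j : ℤ) : M.d (w ^ i) (w ^ j) = M.d 1 (w ^ (j - i)) := by
  rw [M.d_eq_one, ← zpow_neg, ← zpow_add, neg_add_eq_sub]

theorem d_one_zpow (w : G) (i : ℤ) : M.d 1 (w ^ i) = M.d 1 (w ^ i.natAbs) := by
  rcases Int.natAbs_eq i with h | h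
  · conv_lhs => rw [h, zpow_natCast]
  · conv_lhs => rw [h, zpow_neg, zpow_natCast, d_one_inv]

theorem d_one_pow_le (w : G) (n : ℕ) : M.d 1 (w ^ n) ≤ n * M.d 1 w := by
  induction n with
  | zero => simp [M.self]
  | succ n ih =>
    have h := M.tri 1 (w ^ n) (w ^ n * w)
    rw [d_self_mul] at h
    rw [pow_succ, add_mul, one_mul]
    omega

/-- If consecutive powers of `w` form a chain with small Gromov products compared to the length
of its steps, then all powers do. -/
theorem pow_chain_step {w : G} {C : ℕ} (h1 : 2 * M.d 1 w ≤ M.d 1 (w ^ 2) + C)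
    (h2 : C + 2 * M.D < M.d 1 w) (n : ℕ) :
    M.d 1 (w ^ n) + M.d 1 w ≤ M.d 1 (w ^ (n + 1)) + C + M.D := by
  induction n with
  | zero => simp [M.self]; omega
  | succ n ih =>
    have hf := M.four 1 (w ^ n) (w ^ (n + 1)) (w ^ (n + 2))
    rw [show M.d (w ^ n) (w ^ (n + 2)) = M.d 1 (w ^ 2) by rw [pow_add, d_self_mul],
      show M.d (w ^ n) (w ^ (n + 1)) = M.d 1 w by rw [pow_succ, d_self_mul],
      show M.d (w ^ (n + 1)) (w ^ (n + 2)) = M.d 1 w by rw [pow_succ w (n + 1), d_self_mul]] at hf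
    rw [show n + 1 + 1 = n + 2 from rfl]
    -- The first alternative contradicts `ih`, `h1` and `h2`; the second is the claim.
    rcases hf with hf | hf <;> omega

theorem le_d_one_pow {w : G} {C : ℕ} (h1 : 2 * M.d 1 w ≤ M.d 1 (w ^ 2) + C)
    (h2 : C + 2 * M.D < M.d 1 w) (n : ℕ) : n ≤ M.d 1 (w ^ n) := by
  induction n with
  | zero => simp
  | succ n ih =>
    have := M.pow_chain_step h1 h2 n
    omega

/-- A single four-point inequality at `w ^ m`, `w ^ (m + 1)` suffices, so the defect does not grow
with `m` and `n`. -/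
theorem pow_chain {w : G} {C : ℕ} (h1 : 2 * M.d 1 w ≤ M.d 1 (w ^ 2) + C)
    (h2 : C + 2 * M.D < M.d 1 w) (m n : ℕ) :
    M.d 1 (w ^ m) + M.d 1 (w ^ n) ≤ M.d 1 (w ^ (m + n)) + C + 2 * M.D := by
  induction n with
  | zero => simp [M.self]; omega
  | succ n ih =>
    have hf := M.four 1 (w ^ m) (w ^ (m + 1)) (w ^ (m + (n + 1)))
    rw [show M.d (w ^ m) (w ^ (m + (n + 1))) = M.d 1 (w ^ (n + 1)) by rw [pow_add, d_self_mul],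
      show M.d (w ^ m) (w ^ (m + 1)) = M.d 1 w by rw [pow_succ, d_self_mul],
      show M.d (w ^ (m + 1)) (w ^ (m + (n + 1))) = M.d 1 (w ^ n) by
        rw [show m + (n + 1) = (m + 1) + n by omega, pow_add w (m + 1), d_self_mul]] at hf
    have s1 := M.pow_chain_step h1 h2 m
    have s2 := M.pow_chain_step h1 h2 n
    rcases hf with hf | hf <;> omega

theorem le_d_one_zpow {w : G} {C : ℕ} (h1 : 2 * M.d 1 w ≤ M.d 1 (w ^ 2) + C)
    (h2 : C + 2 * M.D < M.d 1 w) (i : ℤ) : i.natAbs ≤ M.d 1 (w ^ i) := by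
  rw [d_one_zpow]
  exact M.le_d_one_pow h1 h2 _

theorem zpow_chain {w : G} {C : ℕ} (h1 : 2 * M.d 1 w ≤ M.d 1 (w ^ 2) + C)
    (h2 : C + 2 * M.D < M.d 1 w) {i j k : ℤ} (h : i ≤ j ∧ j ≤ k ∨ k ≤ j ∧ j ≤ i) :
    M.d (w ^ i) (w ^ j) + M.d (w ^ j) (w ^ k) ≤ M.d (w ^ i) (w ^ k) + (C + 2 * M.D) := by
  simp only [d_zpow]
  rw [M.d_one_zpow w (j - i), M.d_one_zpow w (k - j), M.d_one_zpow w (k - i)]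
  have := M.pow_chain h1 h2 (j - i).natAbs (k - j).natAbs
  rw [show (k - i).natAbs = (j - i).natAbs + (k - j).natAbs by omega]
  omega

/-- A point that is almost between the endpoints of a chain is almost between two consecutive
points of the chain. -/
theorem exists_between_step {f : ℕ → G} {n C C' : ℕ} (hn : 0 < n)
    (hf : ∀ i ≤ n, M.d (f 0) (f i) + M.d (f i) (f n) ≤ M.d (f 0) (f n) + C) {y : G}
    (hy : M.d (f 0) y + M.d y (f n) ≤ M.d (f 0) (f n) + C') :
    ∃ i < n, M.d (f i) y + M.d y (f (i + 1)) ≤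
      M.d (f i) (f (i + 1)) + (C' + 2 * C + 2 * M.D) := by
  have dich : ∀ i ≤ n, M.d (f 0) (f i) + M.d (f i) y ≤ M.d (f 0) y + C + M.D ∨
      M.d y (f i) + M.d (f i) (f n) ≤ M.d y (f n) + C + M.D := by
    intro i hi
    have h1 := M.four (f 0) (f i) (f n) y
    have h2 := hf i hi
    rw [M.symm y (f i)]
    rw [M.symm (f n) y] at h1
    rcases h1 with h1 | h1
    · right; omega
    · left; omega
  let Q : ℕ → Prop := fun i => M.d y (f (i + 1)) + M.d (f (i + 1)) (f n) ≤ M.d y (f n) + C + M.D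
  have hQ : Q (n - 1) := by
    simp only [Q]
    rw [Nat.sub_add_cancel hn, M.self]
    omega
  classical
  have hex : ∃ i, Q i := ⟨_, hQ⟩
  obtain ⟨i, hi, hQi, hmin⟩ : ∃ i, i ≤ n - 1 ∧ Q i ∧ ∀ j < i, ¬ Q j :=
    ⟨Nat.find hex, Nat.find_le hQ, Nat.find_spec hex, fun j hj => Nat.find_min hex hj⟩
  refine ⟨i, by omega, ?_⟩
  have hP : M.d (f 0) (f i) + M.d (f i) y ≤ M.d (f 0) y + C + M.D := by
    rcases i with _ | i
    · rw [M.self]; omega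
    · exact (dich _ (by omega)).resolve_right (hmin i (by omega))
  simp only [Q] at hQi
  have t1 := M.tri (f 0) (f i) (f n)
  have t2 := M.tri (f i) (f (i + 1)) (f n)
  omega

theorem exists_near_step {f : ℕ → G} {n C C' s : ℕ} (hn : 0 < n)
    (hf : ∀ i ≤ n, M.d (f 0) (f i) + M.d (f i) (f n) ≤ M.d (f 0) (f n) + C)
    (hs : ∀ i, M.d (f i) (f (i + 1)) ≤ s) {y : G}
    (hy : M.d (f 0) y + M.d y (f n) ≤ M.d (f 0) (f n) + C') :
    ∃ i < n, M.d (f i) y ≤ 2 * s + C' + 2 * C + 2 * M.D := by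
  obtain ⟨i, hi, h⟩ := M.exists_between_step hn hf hy
  have h1 := hs i
  exact ⟨i, hi, by omega⟩

/-! ### Existence of loxodromic elements -/

/-- A sufficient condition for an element to act as a loxodromic isometry. -/
def Lox (w : G) : Prop := M.d 1 w + 2 * M.D + 1 ≤ M.d 1 (w ^ 2)

theorem lox_chain {w : G} (hw : M.Lox w) : ∃ C, 2 * M.d 1 w ≤ M.d 1 (w ^ 2) + C ∧
    C + 2 * M.D < M.d 1 w := by
  unfold Lox at hw
  have h := M.d_one_pow_le w 2
  exact ⟨2 * M.d 1 w - M.d 1 (w ^ 2), by omega, by omega⟩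

theorem Lox.zpow_chain {M : HypMetric G} {w : G} (hw : M.Lox w) {i j k : ℤ}
    (h : i ≤ j ∧ j ≤ k ∨ k ≤ j ∧ j ≤ i) :
    M.d (w ^ i) (w ^ j) + M.d (w ^ j) (w ^ k) ≤ M.d (w ^ i) (w ^ k) + M.d 1 w := by
  obtain ⟨C, h1, h2⟩ := M.lox_chain hw
  have := M.zpow_chain h1 h2 h
  omega

theorem Lox.le_d_one_zpow {M : HypMetric G} {w : G} (hw : M.Lox w) (i : ℤ) :
    i.natAbs ≤ M.d 1 (w ^ i) := by
  obtain ⟨C, h1, h2⟩ := M.lox_chain hw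
  exact M.le_d_one_zpow h1 h2 i

theorem Lox.zpow_injective {M : HypMetric G} {w : G} (hw : M.Lox w) {i j : ℤ}
    (h : w ^ i = w ^ j) : i = j := by
  have h1 := hw.le_d_one_zpow (j - i)
  rw [← d_zpow, h, M.self] at h1
  omega

theorem d_one_zpow_le (w : G) (i : ℤ) : M.d 1 (w ^ i) ≤ i.natAbs * M.d 1 w := by
  rw [d_one_zpow]
  exact M.d_one_pow_le w _

/-- The points `1, s, st, sts, stst` form a chain with long steps and small Gromov products, so
lengths almost add up. -/
theorem lox_mul {s t : G} {C : ℕ} (hs : 6 * C + 10 * M.D + 2 < M.d 1 s)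
    (ht : 6 * C + 10 * M.D + 2 < M.d 1 t)
    (h1 : M.d 1 s + M.d 1 t ≤ M.d 1 (s * t) + C) (h2 : M.d 1 s + M.d 1 t ≤ M.d 1 (t * s) + C) :
    M.Lox (s * t) := by
  have e1 : M.d s (s * t) = M.d 1 t := M.d_self_mul _ _
  have e2 : M.d (s * t) (s * t * s) = M.d 1 s := M.d_self_mul _ _
  have e3 : M.d (s * t * s) (s * t * s * t) = M.d 1 t := M.d_self_mul _ _
  have e4 : M.d s (s * t * s) = M.d 1 (t * s) := by rw [mul_assoc, d_self_mul]
  have e5 : M.d (s * t) (s * t * s * t) = M.d 1 (s * t) := by rw [mul_assoc (s * t), d_self_mul]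
  have f1 := M.four 1 s (s * t) (s * t * s)
  have f2 := M.four 1 (s * t) (s * t * s) (s * t * s * t)
  have t1 := M.tri 1 s (s * t)
  have e6 : (s * t) ^ 2 = s * t * s * t := by simp [pow_two, mul_assoc]
  unfold Lox
  rw [e6]
  rcases f1 with f1 | f1 <;> rcases f2 with f2 | f2 <;> omega

/-- A set of isometries without loxodromic elements of the form `s` or `s * t` can be conjugated
into a ball of uniform radius. -/
theorem exists_conj_bounded_or_lox (F : Finset G) :
    (∃ s ∈ F, ∃ t ∈ F, ∃ p : G, M.Lox (p⁻¹ * s * p) ∨ M.Lox (p⁻¹ * s * p * (p⁻¹ * t * p))) ∨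
      ∃ p : G, ∀ s ∈ F, M.d 1 (p⁻¹ * s * p) ≤ 100 * M.D + 100 := by
  by_contra! hcon
  obtain ⟨hnl, hbig⟩ := hcon
  let m : G → ℕ := fun p => F.sup fun s => M.d 1 (p⁻¹ * s * p)
  -- `p` minimizes the maximal displacement. Below, `q` is a small step from the base point towards
  -- its image under the most displaced element.
  obtain ⟨p, hp⟩ : ∃ p, ∀ q, m p ≤ m q :=
    ⟨Function.argmin m, fun q => Function.argmin_le m q⟩
  obtain ⟨s, hsF, hs⟩ := hbig p
  have hne : F.Nonempty := ⟨s, hsF⟩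
  obtain ⟨s0, hs0, hs0m⟩ := F.exists_mem_eq_sup hne fun s => M.d 1 (p⁻¹ * s * p)
  have hL : M.d 1 (p⁻¹ * s * p) ≤ m p := F.le_sup (f := fun s => M.d 1 (p⁻¹ * s * p)) hsF
  have hmax : ∀ t ∈ F, M.d 1 (p⁻¹ * t * p) ≤ m p := fun t ht =>
    F.le_sup (f := fun s => M.d 1 (p⁻¹ * s * p)) ht
  obtain ⟨q, hq1, hq2⟩ := M.interm 1 (p⁻¹ * s0 * p) (2 * M.D + 1) (by
    have : m p = M.d 1 (p⁻¹ * s0 * p) := hs0m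
    omega)
  obtain ⟨t, ht, htm⟩ := F.exists_mem_eq_sup hne fun s => M.d 1 ((p * q)⁻¹ * s * (p * q))
  have hmin := hp (p * q)
  have htq : m (p * q) = M.d q (p⁻¹ * t * p * q) := by
    rw [M.d_eq_one]
    refine htm.trans ?_
    congr 1
    group
  have hs0L : m p = M.d 1 (p⁻¹ * s0 * p) := hs0m
  have hmt := hmax t ht
  have n1 := (hnl s0 hs0 t ht p).1
  have n2 := (hnl t ht t ht p).1
  have n3 := (hnl s0 hs0 t ht p).2
  generalize m p = L at *
  generalize m (p * q) = L' at *
  generalize p⁻¹ * s0 * p = a at *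
  generalize p⁻¹ * t * p = b at *
  have e1 : M.d b (b * q) = M.d 1 q := M.d_self_mul _ _
  have e2 : M.d (b * q) 1 = M.d q b⁻¹ := M.d_mul_left_one _ _
  have tq := M.tri q 1 (b * q)
  have tq2 := M.tri 1 b (b * q)
  have sq : M.d q 1 = M.d 1 q := M.symm _ _
  have sa : ∀ x : G, M.d 1 x⁻¹ = M.d 1 x := M.d_one_inv
  have pa : M.d a a⁻¹ = M.d 1 (a ^ 2) := by
    rw [M.symm, M.d_eq_one, inv_inv, pow_two]
  have pb : M.d b b⁻¹ = M.d 1 (b ^ 2) := by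
    rw [M.symm, M.d_eq_one, inv_inv, pow_two]
  unfold Lox at n1 n2
  -- If `a` and `b` point in the same direction, then, `b` not being loxodromic, `q` is nearly
  -- between `1` and each of `b`, `b⁻¹`, and `b` displaces `q` by less than `L`, against minimality.
  -- Otherwise `a * b` is loxodromic.
  by_cases hX : 2 * (2 * M.D + 1) + M.d a b ≤ M.d 1 a + M.d 1 b
  · have f1 := M.four 1 q a b
    have f2 := M.four 1 q b b⁻¹
    have f3 := M.four q 1 (b * q) b
    have := sa b
    have s1 : M.d a q = M.d q a := M.symm _ _
    have s2 : M.d b q = M.d q b := M.symm _ _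
    have s3 : M.d (b * q) b = M.d b (b * q) := M.symm _ _
    have s4 : M.d 1 (b * q) = M.d (b * q) 1 := M.symm _ _
    omega
  · refine n3 (M.lox_mul (C := 5 * M.D + 2) (by omega) (by omega) ?_ ?_)
    · have e : M.d a⁻¹ b = M.d 1 (a * b) := by rw [M.d_eq_one, inv_inv]
      have f := M.four 1 a a⁻¹ b
      have := sa a
      omega
    · have e : M.d b⁻¹ a = M.d 1 (b * a) := by rw [M.d_eq_one, inv_inv]
      have f := M.four 1 b b⁻¹ a
      have := sa b
      have s1 : M.d a b = M.d b a := M.symm _ _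
      omega

/-- An infinite normal subgroup contains a loxodromic element. -/
theorem exists_lox_of_infinite (H : Subgroup G) [H.Normal] (hH : (H : Set G).Infinite) :
    ∃ a ∈ H, M.Lox a := by
  by_contra! hcon
  have hconj : ∀ s ∈ H, ∀ p : G, p⁻¹ * s * p ∈ H := fun s hs p => by
    simpa using ‹H.Normal›.conj_mem s hs p⁻¹
  obtain ⟨F, hFH, hF⟩ := hH.exists_subset_card_eq
    ((M.finite_ball (100 * M.D + 100)).toFinset.card + 1)
  rcases M.exists_conj_bounded_or_lox F with ⟨s, hs, t, ht, p, h | h⟩ | ⟨p, hp⟩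
  · exact hcon _ (hconj s (hFH hs) p) h
  · exact hcon _ (H.mul_mem (hconj s (hFH hs) p) (hconj t (hFH ht) p)) h
  · have := Finset.card_le_card_of_injOn (s := F)
      (t := (M.finite_ball (100 * M.D + 100)).toFinset) (fun s => p⁻¹ * s * p)
      (fun s hs => by simpa using hp s hs) (fun s _ t _ h => by simpa using h)
    omega

end HypMetric

/-! ### The power commensurator of a loxodromic element -/

/-- The elements conjugating some nontrivial power of `a` to a nontrivial power of `a`. -/
def Subgroup.powerCommensurator {G : Type u} [Group G] (a : G) : Subgroup G where
  carrier := {g | ∃ p q : ℤ, p ≠ 0 ∧ q ≠ 0 ∧ SemiconjBy g (a ^ p) (a ^ q)}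
  one_mem' := ⟨1, 1, one_ne_zero, one_ne_zero, SemiconjBy.one_left _⟩
  mul_mem' := by
    rintro g h ⟨p, q, hp, hq, hg⟩ ⟨r, s, hr, hs, hh⟩
    refine ⟨r * p, q * s, mul_ne_zero hr hp, mul_ne_zero hq hs, ?_⟩
    have h1 := hh.zpow_right p
    have h2 := hg.zpow_right s
    rw [← zpow_mul, ← zpow_mul] at h1 h2
    rw [mul_comm s p] at h1
    exact h2.mul_left h1
  inv_mem' := by
    rintro g ⟨p, q, hp, hq, hg⟩
    exact ⟨q, p, hq, hp, hg.inv_symm_left⟩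

theorem Subgroup.self_mem_powerCommensurator {G : Type u} [Group G] (a : G) :
    a ∈ Subgroup.powerCommensurator a :=
  ⟨1, 1, one_ne_zero, one_ne_zero, (SemiconjBy.zpow_right (Commute.refl a) 1)⟩

namespace HypMetric

open Subgroup

variable {G : Type u} [Group G] (M : HypMetric G)

/-- Moving an endpoint far from `y` costs only `M.D`, independently of `R`. -/
theorem between_of_near_left {x x' y z : G} {R C : ℕ} (hx : M.d x x' ≤ R)
    (hy : 2 * R + C + M.D < 2 * M.d x y) (h : M.d x y + M.d y z ≤ M.d x z + C) :
    M.d x' y + M.d y z ≤ M.d x' z + (C + M.D) := by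
  have f := M.four x x' z y
  have t := M.tri x x' y
  have s := M.symm z y
  omega

/-- The chain `g * w' ^ i` passes through `g` and stays within `M.d 1 g` of `w ^ i`. For large `n`
its ends can be replaced by `w ^ (±n)` with an error that does not depend on `g`. -/
theorem exists_between_of_semiconjBy {g w w' : G} {C : ℕ} (hg : SemiconjBy g w' w)
    (hchain : ∀ n : ℕ, 2 * M.d 1 (w' ^ n) ≤ M.d 1 (w' ^ (2 * n)) + C)
    (hgrow : ∀ n : ℕ, n ≤ M.d 1 (w' ^ n)) :
    ∃ n : ℕ, 0 < n ∧
      M.d (w ^ (-n : ℤ)) g + M.d g (w ^ (n : ℤ)) ≤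
        M.d (w ^ (-n : ℤ)) (w ^ (n : ℤ)) + (C + 2 * M.D) := by
  refine ⟨M.d 1 g + C + 2 * M.D + 1, by omega, ?_⟩
  generalize hn : M.d 1 g + C + 2 * M.D + 1 = n
  have h1 := hchain n
  have h2 := hgrow n
  have e1 : M.d (g * w' ^ (-n : ℤ)) g = M.d 1 (w' ^ n) := by
    rw [M.symm, d_self_mul, zpow_neg, d_one_inv, zpow_natCast]
  have e2 : M.d g (g * w' ^ (n : ℤ)) = M.d 1 (w' ^ n) := by rw [d_self_mul, zpow_natCast]
  have e3 : M.d (g * w' ^ (-n : ℤ)) (g * w' ^ (n : ℤ)) = M.d 1 (w' ^ (2 * n)) := by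
    rw [M.mul_left, d_zpow, ← zpow_natCast]
    congr 2; push_cast; ring
  have e4 : ∀ i : ℤ, M.d (g * w' ^ i) (w ^ i) = M.d 1 g := fun i => by
    rw [(hg.zpow_right i).eq, M.symm, d_self_mul]
  have s1 := M.between_of_near_left (e4 (-n)).le (y := g) (z := g * w' ^ (n : ℤ)) (C := C)
    (by omega) (by omega)
  have s2 := M.between_of_near_left (e4 n).le (y := g) (z := w ^ (-n : ℤ)) (C := C + M.D)
    (by rw [M.symm (g * w' ^ (n : ℤ)) g]; omega)
    (by
      rw [M.symm (g * w' ^ (n : ℤ)) g, M.symm g (w ^ (-n : ℤ)),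
        M.symm (g * w' ^ (n : ℤ)) (w ^ (-n : ℤ))]
      omega)
  rw [M.symm g (w ^ (n : ℤ)), M.symm (w ^ (-n : ℤ)) g, M.symm (w ^ (-n : ℤ)) (w ^ (n : ℤ))]
  omega

theorem Lox.exists_near {M : HypMetric G} {a : G} (ha : M.Lox a) {i k : ℤ} {y : G} {C : ℕ}
    (hy : M.d (a ^ i) y + M.d y (a ^ k) ≤ M.d (a ^ i) (a ^ k) + C) :
    ∃ j : ℤ, (i ≤ j ∧ j ≤ k ∨ k ≤ j ∧ j ≤ i) ∧
      M.d (a ^ j) y ≤ 4 * M.d 1 a + C + 2 * M.D := by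
  obtain ⟨ε, hε, hk⟩ : ∃ ε : ℤ, (ε = 1 ∨ ε = -1) ∧ k = i + ε * (k - i).natAbs := by
    rcases le_total i k with h | h
    · exact ⟨1, Or.inl rfl, by omega⟩
    · exact ⟨-1, Or.inr rfl, by omega⟩
  generalize (k - i).natAbs = n at hk
  rcases Nat.eq_zero_or_pos n with rfl | hn
  · have : k = i := by simpa using hk
    subst this
    rw [M.self, M.symm y] at hy
    exact ⟨k, Or.inl ⟨le_rfl, le_rfl⟩, by omega⟩
  · obtain ⟨t, ht, h⟩ := M.exists_near_step (f := fun t : ℕ => a ^ (i + ε * t)) (n := n)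
      (C := M.d 1 a) (C' := C) (s := M.d 1 a) hn (fun t ht => ha.zpow_chain (by
        rcases hε with rfl | rfl <;> omega)) (fun t => by
        rw [M.d_zpow, M.d_one_zpow, show (i + ε * ((t + 1 : ℕ) : ℤ) - (i + ε * t)).natAbs = 1 by
          rcases hε with rfl | rfl <;> omega, pow_one]) (y := y) (by
        simpa [← hk] using hy)
    refine ⟨i + ε * t, ?_, by omega⟩
    rcases hε with rfl | rfl <;> omega

/-- The bound is uniform in `g`; this is what makes the powers of `a` of finite index in the
commensurator. -/
theorem Lox.exists_near_of_mem {M : HypMetric G} {a : G} (ha : M.Lox a) {g : G}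
    (hg : g ∈ powerCommensurator a) : ∃ j : ℤ, M.d (a ^ j) g ≤ 5 * M.d 1 a + 4 * M.D := by
  obtain ⟨p, q, hp, hq, h⟩ := hg
  obtain ⟨n, -, h⟩ := M.exists_between_of_semiconjBy (C := M.d 1 a) h (fun n => by
    have h1 := ha.zpow_chain (i := 0) (j := p * n) (k := p * n + p * n) (by
      generalize p * n = r; omega)
    rw [d_zpow, d_zpow, d_zpow] at h1
    rw [← zpow_natCast, ← zpow_natCast, ← zpow_mul, ← zpow_mul]
    simp only [sub_zero, add_sub_cancel_left] at h1
    rw [show p * ((2 * n : ℕ) : ℤ) = p * n + p * n by push_cast; ring]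
    omega) (fun n => by
    rw [← zpow_natCast, ← zpow_mul]
    refine le_trans ?_ (ha.le_d_one_zpow _)
    rw [Int.natAbs_mul, Int.natAbs_natCast]
    exact Nat.le_mul_of_pos_left _ (Int.natAbs_pos.mpr hp))
  rw [← zpow_mul, ← zpow_mul] at h
  obtain ⟨j, -, hj⟩ := ha.exists_near h
  exact ⟨j, by omega⟩

/-- Pigeonhole: two of the elements `(a ^ j)⁻¹ * (g * a ^ τ t)` of the `K`-ball coincide, and
comparing them shows that `g` conjugates a power of `a` to another. -/
theorem Lox.mem_of_near {M : HypMetric G} {a : G} (ha : M.Lox a) {g : G} {K : ℕ} {τ : ℕ → ℤ}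
    (hτ : Function.Injective τ)
    (h : ∀ t ≤ (M.finite_ball K).toFinset.card, ∃ j : ℤ, M.d (a ^ j) (g * a ^ τ t) ≤ K) :
    g ∈ powerCommensurator a := by
  choose! J hJ using h
  obtain ⟨t, ht, t', ht', hne, heq⟩ := Finset.exists_ne_map_eq_of_card_lt_of_maps_to
    (s := Finset.range ((M.finite_ball K).toFinset.card + 1)) (t := (M.finite_ball K).toFinset)
    (f := fun t => (a ^ J t)⁻¹ * (g * a ^ τ t)) (by simp) (fun t ht => by
      have := hJ t (by simpa [Nat.lt_succ_iff] using ht)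
      rw [M.d_eq_one] at this
      simpa using this)
  have key : g * a ^ (τ t - τ t') = a ^ (J t - J t') * g := by
    rw [zpow_sub, zpow_sub, ← mul_assoc, mul_inv_eq_iff_eq_mul]
    have : g * a ^ τ t = a ^ J t * ((a ^ J t')⁻¹ * (g * a ^ τ t')) := by
      rw [← heq, mul_inv_cancel_left]
    rw [this]
    simp only [mul_assoc]
  have hτne : τ t - τ t' ≠ 0 := fun h0 => hne (hτ (sub_eq_zero.mp h0))
  refine ⟨τ t - τ t', J t - J t', hτne, fun h0 => hτne ?_, key⟩
  rw [h0, zpow_zero, one_mul] at key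
  exact ha.zpow_injective (by simpa using key)

/-! ### Centralizers of `a ^ n * b` -/

/-- The axes of `a` and `b * a * b⁻¹` diverge if `b` does not commensurate `a`. -/
theorem Lox.exists_gromovProduct_bound {M : HypMetric G} {a b : G} (ha : M.Lox a)
    (hb : b ∉ powerCommensurator a) :
    ∃ C, ∀ i j : ℤ, M.d 1 (a ^ i) + M.d 1 (a ^ j) ≤ M.d (a ^ i) (b * a ^ j) + C := by
  by_contra! hcon
  let K := 4 * M.d 1 a + (M.d 1 a + 2 * M.d 1 b + M.D) + 2 * M.D
  let T := (M.finite_ball K).toFinset.card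
  -- The excess is so large that every `b * a ^ (ε * t)` with `t ≤ T` is nearly between `1` and `a ^
  -- i`, hence near a power of `a`.
  obtain ⟨i, j, hij⟩ := hcon (3 * M.d 1 b + M.D + 2 * (T * M.d 1 a) + 1)
  obtain ⟨ε, hε, hj⟩ : ∃ ε : ℤ, (ε = 1 ∨ ε = -1) ∧ j = ε * j.natAbs := by
    rcases le_total 0 j with h | h
    · exact ⟨1, Or.inl rfl, by omega⟩
    · exact ⟨-1, Or.inr rfl, by omega⟩
  have hTj : T ≤ j.natAbs := by
    by_contra! hlt
    have h1 := M.d_one_zpow_le a j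
    have h2 : j.natAbs * M.d 1 a ≤ T * M.d 1 a := Nat.mul_le_mul_right _ hlt.le
    have h3 := M.tri 1 (b * a ^ j) (a ^ i)
    have h4 := M.tri 1 b (b * a ^ j)
    rw [d_self_mul] at h4
    rw [M.symm (b * a ^ j)] at h3
    omega
  refine hb (ha.mem_of_near (K := K) (τ := fun t => ε * t) (fun t t' h => ?_) fun t ht => ?_)
  · rcases hε with rfl | rfl <;> simpa using h
  · have h1 : M.d 1 (a ^ (ε * (t : ℤ))) ≤ T * M.d 1 a := by
      refine (M.d_one_zpow_le a _).trans (Nat.mul_le_mul_right _ ?_)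
      rcases hε with rfl | rfl <;> omega
    have h2 := ha.zpow_chain (i := 0) (j := ε * t) (k := j) (by
      rcases hε with rfl | rfl <;> omega)
    rw [zpow_zero, ← M.mul_left b (a ^ (ε * (t : ℤ)))] at h2
    generalize a ^ (ε * (t : ℤ)) = x at *
    have t1 := M.tri 1 b (b * x)
    have t2 := M.tri 1 b (b * a ^ j)
    have t3 := M.tri b 1 (b * a ^ j)
    have t4 := M.tri 1 (b * x) (a ^ i)
    have sb := M.symm b 1
    have sy := M.symm (b * a ^ j) (a ^ i)
    rw [d_self_mul] at t1 t2 t3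
    have f := M.four 1 (b * x) (b * a ^ j) (a ^ i)
    have : M.d (a ^ (0 : ℤ)) (b * x) + M.d (b * x) (a ^ i) ≤
        M.d (a ^ (0 : ℤ)) (a ^ i) + (M.d 1 a + 2 * M.d 1 b + M.D) := by
      rw [zpow_zero]
      omega
    obtain ⟨k, -, hk⟩ := ha.exists_near this
    exact ⟨k, hk⟩

/-- `g⁻¹` carries a long stretch of the axis of `a` to points nearly between `1` and `a ^ n`, so
`Lox.mem_of_near` applies to `g⁻¹`. -/
theorem Lox.mem_of_between {M : HypMetric G} {a b g : G} (ha : M.Lox a) {n C T : ℕ} {t₀ : ℤ}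
    (hT : (M.finite_ball (4 * M.d 1 a + (C + 2 * M.d 1 b) + 2 * M.D)).toFinset.card ≤ T)
    (h : ∀ t : ℤ, t₀ ≤ t → t ≤ t₀ + T →
      M.d g (a ^ t) + M.d (a ^ t) (g * (a ^ n * b)) ≤ M.d g (g * (a ^ n * b)) + C) :
    g ∈ powerCommensurator a := by
  rw [← inv_mem_iff]
  refine ha.mem_of_near (K := 4 * M.d 1 a + (C + 2 * M.d 1 b) + 2 * M.D)
    (τ := fun t => t₀ + t) (fun t t' h => by simpa using h) fun t ht => ?_
  have h1 := h (t₀ + t) (by omega) (by omega)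
  have e : M.d (g * a ^ n) (g * (a ^ n * b)) = M.d 1 b := by rw [← mul_assoc, d_self_mul]
  have t1 := M.tri (a ^ (t₀ + t : ℤ)) (g * (a ^ n * b)) (g * a ^ n)
  have t2 := M.tri g (g * a ^ n) (g * (a ^ n * b))
  rw [M.symm (g * (a ^ n * b)) (g * a ^ n)] at t1
  have : M.d (a ^ (0 : ℤ)) (g⁻¹ * a ^ (t₀ + t : ℤ)) + M.d (g⁻¹ * a ^ (t₀ + t : ℤ)) (a ^ (n : ℤ)) ≤
      M.d (a ^ (0 : ℤ)) (a ^ (n : ℤ)) + (C + 2 * M.d 1 b) := by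
    have q1 := M.mul_left g 1 (g⁻¹ * a ^ (t₀ + t : ℤ))
    have q2 := M.mul_left g (g⁻¹ * a ^ (t₀ + t : ℤ)) (a ^ n)
    have q3 := M.mul_left g 1 (a ^ n)
    simp only [mul_inv_cancel_left, mul_one] at q1 q2 q3
    rw [zpow_zero, zpow_natCast]
    omega
  obtain ⟨k, -, hk⟩ := ha.exists_near this
  exact ⟨k, hk⟩

/-- For large `n`, the centralizer of `a ^ n * b` is generated by `a ^ n * b` and elements
commensurating `a`. -/
theorem Lox.exists_zpow_mul_mem {M : HypMetric G} {a b : G} (ha : M.Lox a)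
    (hb : b ∉ powerCommensurator a) :
    ∃ n₀ : ℕ, ∀ n ≥ n₀, ∀ c : G, Commute c (a ^ n * b) →
      ∃ i : ℤ, (a ^ n * b) ^ i * c ∈ powerCommensurator a := by
  obtain ⟨Cb, hCb⟩ := ha.exists_gromovProduct_bound hb
  obtain ⟨B, hB⟩ : ∃ B, B = M.d 1 b := ⟨_, rfl⟩
  obtain ⟨s, hs⟩ : ∃ s, s = M.d 1 a := ⟨_, rfl⟩
  obtain ⟨C₁, hC₁⟩ : ∃ C₁, C₁ = 3 * B + Cb + 2 * M.D := ⟨_, rfl⟩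
  obtain ⟨K, hK⟩ : ∃ K, K = 4 * s + (3 * C₁ + 4 * M.D + 2 * B) + 2 * M.D := ⟨_, rfl⟩
  obtain ⟨T, hT⟩ : ∃ T, T = (M.finite_ball (4 * M.d 1 a + ((s + B + Cb + 4 * K) + 2 * M.d 1 b) +
    2 * M.D)).toFinset.card := ⟨_, rfl⟩
  -- With `2 * T`, whichever `j ∈ [0, n]` occurs below, one of `[0, j]`, `[j, n]` has length at
  -- least `T`.
  refine ⟨2 * T + B + C₁ + 1, fun n hn c hc => ?_⟩
  have hbn := ha.le_d_one_zpow n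
  have hnb : M.d (a ^ n) (a ^ n * b) = B := by rw [d_self_mul, hB]
  have hw1 : M.d 1 (a ^ n) ≤ M.d 1 (a ^ n * b) + B := by
    have := M.tri 1 (a ^ n * b) (a ^ n)
    rw [M.symm (a ^ n * b) (a ^ n)] at this
    omega
  have hw1' : M.d 1 (a ^ n * b) ≤ M.d 1 (a ^ n) + B := by
    have := M.tri 1 (a ^ n) (a ^ n * b)
    omega
  have hw2 : 2 * M.d 1 (a ^ n * b) ≤ M.d 1 ((a ^ n * b) ^ 2) + (3 * B + Cb) := by
    have h1 := hCb (-n) n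
    have e : M.d (a ^ (-n : ℤ)) (b * a ^ (n : ℤ)) = M.d 1 (a ^ n * b * a ^ n) := by
      rw [M.d_eq_one, zpow_neg, inv_inv, zpow_natCast, mul_assoc]
    have t := M.tri 1 ((a ^ n * b) ^ 2) (a ^ n * b * a ^ n)
    have e2 : M.d ((a ^ n * b) ^ 2) (a ^ n * b * a ^ n) = B := by
      rw [pow_two, M.mul_left, M.symm, hnb]
    rw [zpow_neg, d_one_inv, zpow_natCast] at h1
    rw [zpow_neg, zpow_natCast] at e
    omega
  rw [zpow_natCast, Int.natAbs_natCast] at hbn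
  have hw3 : 3 * B + Cb + 2 * M.D < M.d 1 (a ^ n * b) := by omega
  -- As `c` commutes with `w = a ^ n * b`, it lies near the axis of `w`, hence nearly between two
  -- consecutive powers.
  obtain ⟨i, hi⟩ : ∃ i : ℤ, M.d ((a ^ n * b) ^ i) c + M.d c ((a ^ n * b) ^ (i + 1)) ≤
      M.d ((a ^ n * b) ^ i) ((a ^ n * b) ^ (i + 1)) + (3 * C₁ + 4 * M.D) := by
    generalize a ^ n * b = w at *
    obtain ⟨N, hN, h⟩ := M.exists_between_of_semiconjBy (C := C₁) (w := w) (w' := w) hc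
      (fun m => by
        have := M.pow_chain hw2 hw3 m m
        rw [two_mul m]
        omega) (M.le_d_one_pow hw2 hw3)
    obtain ⟨i, -, hi⟩ := M.exists_between_step (f := fun t : ℕ => w ^ (-N + t : ℤ)) (n := 2 * N)
      (C := C₁) (C' := C₁ + 2 * M.D) (by omega) (fun t ht => by
        rw [hC₁]
        exact M.zpow_chain hw2 hw3 (by omega)) (y := c) (by
        rw [show (-N + (0 : ℕ) : ℤ) = -N by simp, show (-N + (2 * N : ℕ) : ℤ) = N by push_cast; ring]
        exact h)
    refine ⟨-N + i, ?_⟩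
    simp only [Nat.cast_add, Nat.cast_one] at hi
    rw [add_assoc]
    omega
  have hcomm : ∀ m : ℤ, Commute ((a ^ n * b) ^ m * c) (a ^ n * b) := fun m =>
    ((Commute.refl _).zpow_left m).mul_left hc
  obtain ⟨c', hc'⟩ : ∃ c', c' = (a ^ n * b) ^ (-i) * c := ⟨_, rfl⟩
  have hbet : M.d 1 c' + M.d c' (a ^ n * b) ≤ M.d 1 (a ^ n * b) + (3 * C₁ + 4 * M.D) := by
    rw [← M.mul_left ((a ^ n * b) ^ i), ← M.mul_left ((a ^ n * b) ^ i) c',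
      ← M.mul_left ((a ^ n * b) ^ i) 1 (a ^ n * b), hc', zpow_neg, mul_inv_cancel_left, mul_one,
      ← zpow_add_one]
    exact hi
  have hcc' : Commute c' (a ^ n * b) := hc' ▸ hcomm (-i)
  obtain ⟨j, hj, hjK⟩ : ∃ j : ℤ, (0 ≤ j ∧ j ≤ n) ∧ M.d (a ^ j) c' ≤ K := by
    have t1 := M.tri c' (a ^ n * b) (a ^ n)
    rw [M.symm (a ^ n * b) (a ^ n)] at t1
    have : M.d (a ^ (0 : ℤ)) c' + M.d c' (a ^ (n : ℤ)) ≤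
        M.d (a ^ (0 : ℤ)) (a ^ (n : ℤ)) + (3 * C₁ + 4 * M.D + 2 * B) := by
      rw [zpow_zero, zpow_natCast]
      omega
    obtain ⟨j, hj, hjK⟩ := ha.exists_near this
    exact ⟨j, by omega, by omega⟩
  -- Translated by `a ^ n`, this says that the path from `a ^ j` through `a ^ n` to `a ^ n * b * a ^
  -- j` is nearly geodesic.
  have hprod := hCb (j - n) j
  rw [M.d_one_zpow a (j - n), show (j - n).natAbs = (n - j : ℤ).natAbs by omega,
    ← M.d_one_zpow a (n - j)] at hprod
  have e1 : M.d (a ^ (j - n : ℤ)) (b * a ^ j) = M.d (a ^ j) (a ^ n * b * a ^ j) := by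
    rw [← M.mul_left (a ^ (n : ℤ)), ← zpow_add, add_sub_cancel, zpow_natCast, mul_assoc]
  rw [e1] at hprod
  have hjw : M.d (a ^ n * b * a ^ j) (a ^ n * b * c') ≤ K := by rw [M.mul_left]; exact hjK
  have sj : M.d (a ^ (n : ℤ)) (a ^ n * b) = B := by rw [zpow_natCast, hnb]
  -- If `[j, n]` is long, its powers of `a` lie nearly between `c'` and `c' * w`; otherwise those of
  -- `[0, j]` lie nearly between `c'' = w⁻¹ * c'` and `c'' * w = c'`.
  by_cases hcase : j + T ≤ n
  · refine ⟨-i, ?_⟩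
    rw [← hc']
    refine ha.mem_of_between (b := b) (n := n) (t₀ := j) hT.ge fun t h1 h2 => ?_
    have q1 := ha.zpow_chain (i := j) (j := t) (k := n) (by omega)
    rw [M.d_zpow a j n] at q1
    have q2 := M.tri (a ^ t) (a ^ (n : ℤ)) (a ^ n * b)
    have q3 := M.tri (a ^ t) (a ^ n * b) (a ^ n * b * a ^ j)
    rw [M.d_self_mul] at q3
    rw [hcc'.eq]
    have r1 := M.tri c' (a ^ j) (a ^ t)
    have r2 := M.tri (a ^ t) (a ^ n * b * a ^ j) (a ^ n * b * c')
    have r3 := M.tri (a ^ j) c' (a ^ n * b * a ^ j)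
    have r4 := M.tri c' (a ^ n * b * c') (a ^ n * b * a ^ j)
    rw [M.symm c' (a ^ j)] at r1
    rw [M.symm (a ^ n * b * c') (a ^ n * b * a ^ j)] at r4
    omega
  · refine ⟨-1 + -i, ?_⟩
    obtain ⟨c'', hc''⟩ : ∃ c'', c'' = (a ^ n * b) ^ (-1 + -i) * c := ⟨_, rfl⟩
    have hwc : c'' * (a ^ n * b) = c' := by
      rw [hc'', (hcomm (-1 + -i)).eq, hc', zpow_add, zpow_neg_one, mul_assoc (a ^ n * b)⁻¹,
        mul_inv_cancel_left]
    have hwc2 : a ^ n * b * c'' = c' := by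
      rw [hc'', hc', zpow_add, zpow_neg_one, mul_assoc (a ^ n * b)⁻¹,
        mul_inv_cancel_left]
    rw [← hc'']
    refine ha.mem_of_between (b := b) (n := n) (t₀ := 0) hT.ge fun t h1 h2 => ?_
    rw [hwc]
    have q1 := ha.zpow_chain (i := 0) (j := t) (k := j) (by omega)
    have z1 : a ^ (0 : ℤ) = 1 := zpow_zero a
    rw [z1] at q1
    have q2 : M.d c'' ((a ^ n * b)⁻¹ * a ^ j) ≤ K := by
      rw [← M.mul_left (a ^ n * b), hwc2, mul_inv_cancel_left, M.symm]
      exact hjK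
    have q3 : M.d ((a ^ n * b)⁻¹ * a ^ j) (a ^ j) = M.d (a ^ j) (a ^ n * b * a ^ j) := by
      rw [← M.mul_left (a ^ n * b), mul_inv_cancel_left]
    have q4 : M.d ((a ^ n * b)⁻¹ * a ^ j) 1 ≤ M.d 1 (a ^ (n - j : ℤ)) + B := by
      rw [← M.mul_left (a ^ n * b), mul_inv_cancel_left, mul_one]
      have := M.tri (a ^ j) (a ^ (n : ℤ)) (a ^ n * b)
      rw [M.d_zpow] at this
      omega
    have r1 := M.tri c'' ((a ^ n * b)⁻¹ * a ^ j) (a ^ t)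
    have r2 := M.tri ((a ^ n * b)⁻¹ * a ^ j) 1 (a ^ t)
    have r3 := M.tri (a ^ t) (a ^ j) c'
    have r4 := M.tri ((a ^ n * b)⁻¹ * a ^ j) c'' (a ^ j)
    have r5 := M.tri c'' c' (a ^ j)
    rw [M.symm ((a ^ n * b)⁻¹ * a ^ j) c''] at r4
    rw [M.symm c' (a ^ j)] at r5
    omega

end HypMetric

/-! ### Exponents and torsion in the power commensurator -/

namespace HypMetric

open Subgroup

variable {G : Type u} [Group G] {M : HypMetric G}

/-- The powers of a loxodromic element have finite index in its power commensurator, even if the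
exponents are restricted to multiples of `N`. -/
theorem Lox.exists_eq_zpow_mul {a : G} (ha : M.Lox a) {ι : Type*} [Infinite ι] {f : ι → G}
    (hf : ∀ i, f i ∈ powerCommensurator a) (N : ℕ) (hN : 0 < N) :
    ∃ i i', i ≠ i' ∧ ∃ m : ℤ, (N : ℤ) ∣ m ∧ f i = a ^ m * f i' := by
  choose j hj using fun i => ha.exists_near_of_mem (hf i)
  have := (M.finite_ball (5 * M.d 1 a + 4 * M.D)).to_subtype
  have : NeZero N := ⟨hN.ne'⟩
  -- Pigeonhole on the bounded remainder together with the exponent modulo `N`.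
  obtain ⟨i, i', hne, h⟩ := Finite.exists_ne_map_eq_of_infinite
    (fun i => ((⟨(a ^ j i)⁻¹ * f i, by rw [Set.mem_ofPred_eq, ← M.d_eq_one]; exact hj i⟩ :
      {g | M.d 1 g ≤ 5 * M.d 1 a + 4 * M.D}), (j i : ZMod N)))
  rw [Prod.mk.injEq, Subtype.mk.injEq] at h
  refine ⟨i, i', hne, j i - j i', ?_, ?_⟩
  · rw [← ZMod.intCast_zmod_eq_zero_iff_dvd]
    push_cast
    rw [h.2, sub_self]
  · rw [zpow_sub, mul_assoc, ← h.1, mul_inv_cancel_left]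

theorem Lox.exists_zpow_eq {a e : G} (ha : M.Lox a) (he : e ∈ powerCommensurator a) :
    ∃ k : ℕ, 0 < k ∧ ∃ m : ℤ, e ^ k = a ^ m := by
  obtain ⟨i, i', hne, m, -, h⟩ := ha.exists_eq_zpow_mul (f := fun i : ℕ => e ^ i)
    (fun i => pow_mem he i) 1 one_pos
  rcases lt_or_gt_of_ne hne with hlt | hlt
  · refine ⟨i' - i, by omega, -m, ?_⟩
    rw [pow_sub e hlt.le, h]
    group
  · refine ⟨i - i', by omega, m, ?_⟩
    rw [pow_sub e hlt.le, h]
    group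

/-- `e ^ k` conjugates `a ^ (p ^ k)` to `a ^ (q ^ k)`; some positive power of `e` is a power of `a`
and commutes with both, so `p ^ k = q ^ k`. -/
theorem Lox.natAbs_eq_of_semiconjBy {a e : G} (ha : M.Lox a) {p q : ℤ} (hp : p ≠ 0) (hq : q ≠ 0)
    (h : SemiconjBy e (a ^ p) (a ^ q)) : q = p ∨ q = -p := by
  have hpow : ∀ k : ℕ, SemiconjBy (e ^ k) (a ^ (p ^ k)) (a ^ (q ^ k)) := by
    intro k
    induction k with
    | zero => simp
    | succ k ih =>
      have h1 := ih.zpow_right p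
      have h2 := h.zpow_right (q ^ k)
      rw [← zpow_mul, ← zpow_mul] at h1 h2
      rw [mul_comm (q ^ k) p] at h1
      have h3 := h2.mul_left h1
      rwa [← pow_succ', ← pow_succ, ← pow_succ'] at h3
  obtain ⟨k, hk, m, hm⟩ := ha.exists_zpow_eq ⟨p, q, hp, hq, h⟩
  have h1 := hpow k
  rw [hm] at h1
  have h2 : SemiconjBy (a ^ m) (a ^ (p ^ k)) (a ^ (p ^ k)) :=
    (Commute.refl a).zpow_zpow _ _
  have h3 : a ^ (p ^ k) = a ^ (q ^ k) := mul_right_cancel (h2.eq.symm.trans h1.eq)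
  have h4 := congrArg Int.natAbs (ha.zpow_injective h3)
  rw [Int.natAbs_pow, Int.natAbs_pow] at h4
  have h5 := Nat.pow_left_injective hk.ne' h4
  omega

/-- Each element is `a ^ j * f` with `f` in a fixed ball, and `a ^ j` commutes with powers of `a`;
so the product of exponents over the ball works. Ball elements outside the commensurator get
exponent `1`. -/
theorem Lox.exists_uniform_exponent {a : G} (ha : M.Lox a) :
    ∃ N : ℕ, 0 < N ∧ ∀ e ∈ powerCommensurator a,
      SemiconjBy e (a ^ (N : ℤ)) (a ^ (N : ℤ)) ∨ SemiconjBy e (a ^ (N : ℤ)) (a ^ (-N : ℤ)) := by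
  classical
  have hex : ∀ e : G, ∃ p : ℕ, 0 < p ∧ (e ∈ powerCommensurator a →
      SemiconjBy e (a ^ (p : ℤ)) (a ^ (p : ℤ)) ∨ SemiconjBy e (a ^ (p : ℤ)) (a ^ (-p : ℤ))) := by
    intro e
    by_cases he : e ∈ powerCommensurator a
    · obtain ⟨p, q, hp, hq, h⟩ := he
      obtain ⟨r, hr⟩ : ∃ r : ℕ, r = p.natAbs := ⟨_, rfl⟩
      refine ⟨r, hr ▸ Int.natAbs_pos.mpr hp, fun _ => ?_⟩
      have hinv : SemiconjBy e (a ^ (-p)) (a ^ (-q)) := by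
        simpa using h.inv_right
      have hqp := ha.natAbs_eq_of_semiconjBy hp hq h
      rcases (by omega : p = r ∧ q = r ∨ p = r ∧ q = -r ∨ -p = r ∧ -q = r ∨ -p = r ∧ -q = -r)
        with ⟨h1, h2⟩ | ⟨h1, h2⟩ | ⟨h1, h2⟩ | ⟨h1, h2⟩
      · rw [h1, h2] at h
        exact Or.inl h
      · rw [h1, h2] at h
        exact Or.inr h
      · rw [h1, h2] at hinv
        exact Or.inl hinv
      · rw [h1, h2] at hinv
        exact Or.inr hinv
    · exact ⟨1, one_pos, fun h => absurd h he⟩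
  choose p hp hpe using hex
  let B := (M.finite_ball (5 * M.d 1 a + 4 * M.D)).toFinset
  refine ⟨∏ f ∈ B, p f, Finset.prod_pos fun f _ => hp f, fun e he => ?_⟩
  obtain ⟨j, hj⟩ := ha.exists_near_of_mem he
  obtain ⟨f, hf⟩ : ∃ f, f = (a ^ j)⁻¹ * e := ⟨_, rfl⟩
  have hfB : f ∈ B := by
    rw [M.d_eq_one, ← hf] at hj
    simpa [B] using hj
  have haE : a ∈ powerCommensurator a := self_mem_powerCommensurator a
  have hfE : f ∈ powerCommensurator a := hf ▸ mul_mem (inv_mem (zpow_mem haE j)) he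
  have hef : e = a ^ j * f := by rw [hf, mul_inv_cancel_left]
  obtain ⟨r, hr⟩ := Finset.dvd_prod_of_mem p hfB
  rw [hr, Nat.cast_mul, ← neg_mul, zpow_mul, zpow_mul, hef]
  refine (hpe f hfE).imp (fun h => ?_) fun h => ?_
  · have h2 : SemiconjBy (a ^ j) (a ^ (p f : ℤ)) (a ^ (p f : ℤ)) := (Commute.refl a).zpow_zpow _ _
    exact (h2.mul_left h).zpow_right r
  · have h2 : SemiconjBy (a ^ j) (a ^ (-p f : ℤ)) (a ^ (-p f : ℤ)) := (Commute.refl a).zpow_zpow _ _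
    exact (h2.mul_left h).zpow_right r

/-- An element commensurating `a` and commuting with `a ^ n * b` for a large multiple `n` of the
uniform exponent commutes with `a ^ n` and with `b`. -/
theorem Lox.exists_exponent_commute {a b : G} (ha : M.Lox a) (hb : b ∉ powerCommensurator a)
    {N : ℕ} (hN : 0 < N) (hNE : ∀ e ∈ powerCommensurator a,
      SemiconjBy e (a ^ (N : ℤ)) (a ^ (N : ℤ)) ∨ SemiconjBy e (a ^ (N : ℤ)) (a ^ (-N : ℤ))) :
    ∃ n : ℕ, ∀ c : G, Commute c (a ^ n * b) → ∃ i : ℤ,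
      (a ^ n * b) ^ i * c ∈ powerCommensurator a ∧
        Commute ((a ^ n * b) ^ i * c) (a ^ (N : ℤ)) ∧ Commute ((a ^ n * b) ^ i * c) b := by
  obtain ⟨n₀, hn₀⟩ := ha.exists_zpow_mul_mem hb
  obtain ⟨C, hC⟩ := ha.exists_gromovProduct_bound hb
  obtain ⟨r, hr⟩ : ∃ r, r = n₀ + C + 2 * (5 * M.d 1 a + 4 * M.D) + M.d 1 b + 1 := ⟨_, rfl⟩
  have hle : r ≤ N * r := Nat.le_mul_of_pos_left _ hN
  refine ⟨N * r, fun c hc => ?_⟩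
  obtain ⟨i, hi⟩ := hn₀ (N * r) (by omega) c hc
  refine ⟨i, hi, ?_⟩
  have hcomm : Commute ((a ^ (N * r) * b) ^ i * c) (a ^ (N * r) * b) :=
    ((Commute.refl _).zpow_left i).mul_left hc
  generalize (a ^ (N * r) * b) ^ i * c = e at *
  obtain ⟨n, hn⟩ : ∃ n, n = N * r := ⟨_, rfl⟩
  rw [← hn] at hle hcomm
  have hcast : (n : ℤ) = N * r := by rw [hn]; push_cast; rfl
  rcases hNE e hi with h | h
  · refine ⟨h, ?_⟩
    have h1 : SemiconjBy e (a ^ n) (a ^ n) := by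
      have := h.zpow_right r
      rw [← zpow_mul, ← hcast] at this
      simpa using this
    have h2 := hcomm.eq
    rw [← mul_assoc, h1.eq, mul_assoc, mul_assoc] at h2
    exact mul_left_cancel h2
  -- If `e` inverted `a ^ n`, then `e * b = a ^ (2 * n) * b * e` with `e` near some `a ^ j` would
  -- bound `M.d (a ^ j) (a ^ (2 * n) * b * a ^ j)`, which is at least `2 * n - C`; `r` was chosen to
  -- exclude this.
  · exfalso
    have h1 : e * a ^ (n : ℤ) = a ^ (-n : ℤ) * e := by
      have := h.zpow_right r
      rw [← zpow_mul, ← zpow_mul, neg_mul, ← hcast] at this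
      exact this.eq
    have h2 : e * b = a ^ (2 * n : ℤ) * b * e := by
      have h3 := hcomm.eq
      rw [← zpow_natCast, ← mul_assoc, h1, mul_assoc, zpow_neg, inv_mul_eq_iff_eq_mul] at h3
      rw [h3, two_mul, zpow_add]
      simp only [mul_assoc]
    obtain ⟨j, hj⟩ := ha.exists_near_of_mem hi
    have h4 := hC (j - 2 * n) j
    have e1 : M.d (a ^ (j - 2 * n)) (b * a ^ j) = M.d (a ^ j) (a ^ (2 * n : ℤ) * b * a ^ j) := by
      rw [← M.mul_left (a ^ (2 * n : ℤ)), ← zpow_add, add_sub_cancel, mul_assoc]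
    have e2 : M.d (e * b) (a ^ (2 * n : ℤ) * b * a ^ j) = M.d (a ^ j) e := by
      rw [h2, M.mul_left, M.symm]
    have e3 : M.d e (e * b) = M.d 1 b := M.d_self_mul _ _
    have t1 := M.tri (a ^ j) e (a ^ (2 * n : ℤ) * b * a ^ j)
    have t2 := M.tri e (e * b) (a ^ (2 * n : ℤ) * b * a ^ j)
    have g1 := ha.le_d_one_zpow (j - 2 * n)
    have g2 := ha.le_d_one_zpow j
    omega

theorem Lox.exists_pow_eq_one {a b e : G} (ha : M.Lox a) (hb : b ∉ powerCommensurator a)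
    (he : e ∈ powerCommensurator a) (heb : Commute e b) : ∃ k : ℕ, 0 < k ∧ e ^ k = 1 := by
  obtain ⟨k, hk, m, hm⟩ := ha.exists_zpow_eq he
  refine ⟨k, hk, ?_⟩
  by_cases h0 : m = 0
  · rw [hm, h0, zpow_zero]
  · refine absurd ⟨m, m, h0, h0, ?_⟩ hb
    have := heb.pow_left k
    rw [hm] at this
    exact this.symm

/-- Among infinitely many, two would differ by some `a ^ (N * r)` commuting with both; a common
power kills the torsion and forces `N * r = 0`. -/
theorem Lox.finite_torsion {a : G} (ha : M.Lox a) {N : ℕ} (hN : 0 < N) :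
    {e : G | e ∈ powerCommensurator a ∧ Commute e (a ^ (N : ℤ)) ∧
      ∃ k : ℕ, 0 < k ∧ e ^ k = 1}.Finite := by
  by_contra hinf
  have := Set.Infinite.to_subtype hinf
  obtain ⟨⟨e, he, hec, k, hk, hek⟩, ⟨e', he', hec', k', hk', hek'⟩, hne, m, ⟨r, rfl⟩, h⟩ :=
    ha.exists_eq_zpow_mul (f := fun e : {e : G | e ∈ powerCommensurator a ∧
      Commute e (a ^ (N : ℤ)) ∧ ∃ k : ℕ, 0 < k ∧ e ^ k = 1} => (e : G)) (fun e => e.2.1) N hN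
  simp only at h
  have hc : Commute (a ^ (N * r : ℤ)) e' := by
    rw [zpow_mul]
    exact (hec'.zpow_right r).symm
  have h1 : e ^ (k * k') = a ^ (N * r * (k * k' : ℕ) : ℤ) := by
    rw [h, hc.mul_pow, mul_comm k k', pow_mul e', hek', one_pow, mul_one, zpow_mul a _ ((k' * k : ℕ) : ℤ),
      zpow_natCast]
  rw [pow_mul, hek, one_pow, ← zpow_zero a] at h1
  have h2 := ha.zpow_injective h1
  have h3 : (N * r : ℤ) = 0 := by
    rcases mul_eq_zero.mp h2.symm with h | h
    · exact h
    · exact absurd (Nat.cast_eq_zero.mp h) (Nat.mul_pos hk hk').ne'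
  rw [h3, zpow_zero, one_mul] at h
  exact hne (Subtype.ext h)

theorem Lox.isElementary {a : G} (ha : M.Lox a) {H : Subgroup G} (haH : a ∈ H) (K : Subgroup H)
    [K.FiniteIndex] (hK : ∀ h ∈ K, (h : G) ∈ powerCommensurator a) : H.IsElementary := by
  refine ⟨zpowers ⟨a, haH⟩, inferInstance, ?_⟩
  let E := (powerCommensurator a).subgroupOf H
  have haE : a ∈ powerCommensurator a := self_mem_powerCommensurator a
  have hCE : zpowers ⟨a, haH⟩ ≤ E := by
    rw [zpowers_le]
    exact haE
  have : E.FiniteIndex := finiteIndex_of_le (H := K) fun h hh => hK h hh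
  refine ⟨?_⟩
  rw [← relIndex_mul_index hCE]
  refine mul_ne_zero ?_ FiniteIndex.index_ne_zero
  have : Finite (E ⧸ (zpowers (⟨a, haH⟩ : H)).subgroupOf E) := by
    by_contra hinf
    rw [not_finite_iff_infinite] at hinf
    obtain ⟨x, y, hne, m, -, h⟩ := ha.exists_eq_zpow_mul
      (f := fun q : E ⧸ (zpowers (⟨a, haH⟩ : H)).subgroupOf E => (((q.out : E) : H) : G)⁻¹)
      (fun q => inv_mem q.out.2) 1 one_pos
    apply hne
    rw [← QuotientGroup.out_eq' x, ← QuotientGroup.out_eq' y, QuotientGroup.eq, mem_subgroupOf]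
    refine ⟨m, Subtype.ext ?_⟩
    push_cast
    rw [h, inv_mul_cancel_right]
  exact Nat.card_ne_zero.mpr ⟨inferInstance, this⟩

/-! ### Pointwise inner automorphisms are inner -/

open scoped Pointwise in
/-- An automorphism of a non-elementary normal subgroup `H` induced by `x` that fixes every
element of `H` up to conjugacy in `H` is inner, if no nontrivial finite subgroup is normalized
by `H`. -/
theorem mem_of_forall_exists_commute (M : HypMetric G) {H : Subgroup G} [H.Normal]
    (hne : ¬ H.IsElementary)
    (hE : ∀ K : Subgroup G, Finite K → H ≤ normalizer (K : Set G) → K = ⊥) {x : G}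
    (hx : ∀ h ∈ H, ∃ c, x⁻¹ * c ∈ H ∧ Commute c h) : x ∈ H := by
  classical
  have hinf : (H : Set G).Infinite := by
    intro hfin
    have : Finite H := hfin
    exact hne ⟨⊥, inferInstance, inferInstance⟩
  obtain ⟨a, haH, ha⟩ := M.exists_lox_of_infinite H hinf
  obtain ⟨N, hN, hNE⟩ := ha.exists_uniform_exponent
  have hfin := ha.finite_torsion hN
  let F := hfin.toFinset.filter fun e => x⁻¹ * e ∈ H
  have hcov : ∀ b ∈ H, b ∈ powerCommensurator a ∨ ∃ e ∈ F, Commute e b := by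
    intro b hbH
    by_cases hb : b ∈ powerCommensurator a
    · exact Or.inl hb
    · obtain ⟨n, hn⟩ := ha.exists_exponent_commute hb hN hNE
      have hw : a ^ n * b ∈ H := mul_mem (pow_mem haH n) hbH
      obtain ⟨c, hcx, hc⟩ := hx _ hw
      obtain ⟨i, h1, h2, h3⟩ := hn c hc
      refine Or.inr ⟨_, ?_, h3⟩
      simp only [F, Finset.mem_filter, Set.Finite.mem_toFinset, Set.mem_ofPred_eq]
      refine ⟨⟨h1, h2, ha.exists_pow_eq_one hb h1 h3⟩, ?_⟩
      have := mul_mem (‹H.Normal›.conj_mem _ (zpow_mem hw i) x⁻¹) hcx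
      simpa [mul_assoc] using this
  let P : Option F → Subgroup H := fun o =>
    o.elim ((powerCommensurator a).subgroupOf H) fun e => (centralizer {(e : G)}).subgroupOf H
  -- B. H. Neumann's lemma: in a finite cover by cosets, some subgroup has finite index.
  obtain ⟨o, -, ho⟩ := exists_finiteIndex_of_leftCoset_cover (s := Finset.univ) (H := P)
    (g := fun _ => (1 : H)) (by
      rw [Set.eq_univ_iff_forall]
      intro b
      simp only [one_smul, Set.mem_iUnion]
      rcases hcov b b.2 with h | ⟨e, he, h⟩
      · exact ⟨none, Finset.mem_univ _, h⟩
      · refine ⟨some ⟨e, he⟩, Finset.mem_univ _, ?_⟩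
        rw [SetLike.mem_coe]
        simp only [P, Option.elim_some, mem_subgroupOf, mem_centralizer_singleton_iff]
        exact h.eq.symm)
  rcases o with _ | ⟨e, he⟩
  · exact absurd (ha.isElementary haH (P none) fun h hh => hh) hne
  · have hex : x⁻¹ * e ∈ H := (Finset.mem_filter.mp he).2
    let Z := ((centralizer {e}).subgroupOf H).normalCore
    have : ((centralizer {e}).subgroupOf H).FiniteIndex := ho
    obtain ⟨b, hbZ, hb⟩ : ∃ b ∈ Z, (b : G) ∉ powerCommensurator a := by
      by_contra! hcon
      exact hne (ha.isElementary haH Z hcon)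
    let K := closure {g | ∃ h ∈ H, g = h * e * h⁻¹}
    have hKZ : ∀ z ∈ Z, ∀ k ∈ K, Commute k (z : G) := by
      intro z hz k hk
      have : K ≤ centralizer {(z : G)} := by
        rw [closure_le]
        rintro _ ⟨h, hh, rfl⟩
        rw [SetLike.mem_coe, mem_centralizer_singleton_iff]
        have h1 := Subgroup.normalCore_le _ (normalCore_normal _ |>.conj_mem z hz ⟨h, hh⟩⁻¹)
        rw [mem_subgroupOf, mem_centralizer_singleton_iff] at h1
        have h2 := (Commute.conj_iff h).mpr (show Commute _ e from h1)
        exact (by simpa [mul_assoc] using h2 : Commute (z : G) (h * e * h⁻¹)).eq.symm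
      exact mem_centralizer_singleton_iff.mp (this hk)
    -- `K` centralizes a power of `a`, hence lies in the commensurator; if infinite, it would
    -- contain some `a ^ m` with `m ≠ 0`, which `b` would centralize.
    have hKfin : Finite K := by
      by_contra hKinf
      rw [not_finite_iff_infinite] at hKinf
      obtain ⟨r, hr, hrZ⟩ : ∃ r : ℕ, 0 < r ∧ (⟨a, haH⟩ : H) ^ r ∈ Z := by
        obtain ⟨r, hr, -, h⟩ := exists_pow_mem_of_index_ne_zero
          (FiniteIndex.index_ne_zero (H := Z)) ⟨a, haH⟩
        exact ⟨r, hr, h⟩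
      obtain ⟨k, k', hkk, m, -, h⟩ := ha.exists_eq_zpow_mul (f := fun k : K => (k : G))
        (fun k => ⟨r, r, by exact_mod_cast hr.ne', by exact_mod_cast hr.ne', by
          have := hKZ _ hrZ k k.2
          rw [zpow_natCast]
          exact this⟩) 1 one_pos
      have hm : a ^ m ∈ K := by
        have : a ^ m = k * (k' : G)⁻¹ := by rw [h, mul_inv_cancel_right]
        rw [this]
        exact mul_mem k.2 (inv_mem k'.2)
      have hm0 : m ≠ 0 := by
        rintro rfl
        exact hkk (Subtype.ext (by simpa using h))
      exact hb ⟨m, m, hm0, hm0, (hKZ b hbZ _ hm).symm⟩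
    have hnorm : H ≤ normalizer (K : Set G) := by
      rw [le_normalizer_closure_iff]
      rintro g hg _ ⟨h, hh, rfl⟩
      exact subset_closure ⟨g * h, mul_mem hg hh, by group⟩
    have he1 : e ∈ K := subset_closure ⟨1, one_mem _, by simp⟩
    rw [hE K hKfin hnorm, mem_bot] at he1
    rw [he1, mul_one] at hex
    exact inv_mem_iff.mp hex

end HypMetric

/-! ### The fibre product and the conclusion -/

open Subgroup

theorem Subgroup.mem_fibreProduct_iff {G : Type u} [Group G] {N : Subgroup G} [N.Normal]
    {g : G × G} : g ∈ N.fibreProduct ↔ g.1⁻¹ * g.2 ∈ N := by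
  rw [← QuotientGroup.eq]
  exact Iff.rfl

/-- If `x` cannot be separated from `H` in finite quotients of `G` and the fibre product is
conjugacy separable, then `x` acts on `H` by a pointwise inner automorphism. -/
theorem Group.IsConjugacySeparable.exists_commute {G : Type u} [Group G] {H : Subgroup G}
    [H.Normal] (hT : Group.IsConjugacySeparable H.fibreProduct) {x : G}
    (hx : ∀ K : Subgroup G, K.FiniteIndex → H ≤ K → x ∈ K) {h : G} (hh : h ∈ H) :
    ∃ c, x⁻¹ * c ∈ H ∧ Commute c h := by
  have hxh : x * h * x⁻¹ ∈ H := ‹H.Normal›.conj_mem h hh x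
  let p : H.fibreProduct := ⟨(h, h), mem_fibreProduct_iff.mpr (by simp)⟩
  let q : H.fibreProduct :=
    ⟨(h, x * h * x⁻¹), mem_fibreProduct_iff.mpr (mul_mem (inv_mem hh) hxh)⟩
  by_cases hpq : IsConj p q
  · obtain ⟨⟨⟨a, b⟩, hab⟩, hc⟩ := isConj_iff.mp hpq
    rw [mem_fibreProduct_iff] at hab
    simp only [p, q, Subtype.ext_iff, Prod.ext_iff, Subgroup.coe_mul, Subgroup.coe_inv,
      Prod.fst_mul, Prod.snd_mul, Prod.fst_inv, Prod.snd_inv] at hc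
    obtain ⟨h1, h2⟩ := hc
    -- `a` commutes with `h`, and so does `b⁻¹ * x` because `b` and `x` conjugate `h` to the same
    -- element.
    refine ⟨a * (b⁻¹ * x), ?_, ?_⟩
    · have h3 : a * b⁻¹ ∈ H := ‹H.Normal›.mem_comm (by simpa using inv_mem hab)
      have h4 := ‹H.Normal›.conj_mem _ h3 x⁻¹
      simpa [mul_assoc] using h4
    · have c1 : Commute a h := mul_inv_eq_iff_eq_mul.mp h1
      refine c1.mul_left ?_
      have h5 : b * h * b⁻¹ = x * h * x⁻¹ := h2
      have : b⁻¹ * (b * h * b⁻¹) * x = b⁻¹ * (x * h * x⁻¹) * x := by rw [h5]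
      simp only [mul_assoc, inv_mul_cancel_left, inv_mul_cancel, mul_one] at this
      exact (by simpa [mul_assoc] using this.symm : b⁻¹ * x * h = h * (b⁻¹ * x))
  · exfalso
    obtain ⟨Q, _, _, ψ, hψ⟩ := hT p q hpq
    let diag : G →* H.fibreProduct :=
      { toFun := fun g => ⟨(g, g), mem_fibreProduct_iff.mpr (by simp)⟩
        map_one' := rfl
        map_mul' := fun _ _ => rfl }
    let K := (ψ.comp diag).ker
    have : K.FiniteIndex := finiteIndex_ker _
    have hxK : x ∈ H ⊔ K := hx _ (finiteIndex_of_le le_sup_right) le_sup_left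
    obtain ⟨u, hu, g, hg, rfl⟩ := mem_sup_of_normal_left.mp hxK
    have hg1 : ψ (diag g) = 1 := hg
    let l : H.fibreProduct := ⟨(h, 1), mem_fibreProduct_iff.mpr (by simpa using hh)⟩
    let r : H.fibreProduct := ⟨(1, h), mem_fibreProduct_iff.mpr (by simpa using hh)⟩
    let v : H.fibreProduct := ⟨(1, u), mem_fibreProduct_iff.mpr (by simpa using hu)⟩
    have hp : p = l * r := by
      ext <;> simp [p, l, r]
    -- `ψ` kills `diag g`, so it sends the middle factor to `ψ (l * r) = ψ p`.
    have hq : q = v * (l * (diag g * r * (diag g)⁻¹)) * v⁻¹ := by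
      ext <;> simp [q, l, r, v, diag, mul_assoc]
    refine hψ (isConj_iff.mpr ⟨ψ v, ?_⟩)
    rw [hq, hp]
    simp [hg1]

theorem proposition7p5 {G : Type u} [Group G] (hG : Group.IsGromovHyperbolic G)
    (H : Subgroup G) [H.Normal] (hfg : H.FG) (hne : ¬ H.IsElementary)
    (hE : H.maxFiniteNormalized = ⊥)
    (hT : Group.IsConjugacySeparable H.fibreProduct) :
    Group.ResiduallyFinite (G ⧸ H) := by
  obtain ⟨M⟩ := hG.nonempty_hypMetric
  rw [Group.residuallyFinite_iff_forall_finiteIndex]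
  intro g hg
  induction g using QuotientGroup.induction_on with
  | H x =>
    rw [QuotientGroup.eq_one_iff]
    refine M.mem_of_forall_exists_commute hne (fun K hK hKn => ?_) fun h hh =>
      hT.exists_commute (fun K hK hHK => ?_) hh
    · exact le_bot_iff.mp (hE ▸ le_sSup (a := K) ⟨hK, hKn⟩)
    · have hfi : (K.map (QuotientGroup.mk' H)).FiniteIndex :=
        ⟨ne_zero_of_dvd_ne_zero hK.index_ne_zero
            (K.index_map_dvd (QuotientGroup.mk'_surjective H))⟩
      have := hg (K.map (QuotientGroup.mk' H))
      obtain ⟨k, hk, hkx⟩ := this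
      rw [QuotientGroup.mk'_apply, QuotientGroup.eq] at hkx
      simpa using mul_mem hk (hHK hkx)
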